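/- Let $n\ge 0$ and $k=n+2$. For $v=(m,n')\in\mathbb Z^2$ put $G(v)=\{(z,w)\in \mathrm U(1)\times \mathrm U(1) : z^{m}w^{n'}=1\}$. Let $M$ be a closed connected smooth four-manifold with a smooth action of $T=\mathrm U(1)\times\mathrm U(1)$ whose orbit space is the closed disc, realized as $\overline{\mathcal H^2}=\{(x_1,x_2): x_2\ge 0\}\cup\{\infty\}$, such that the interior of the disc parametrizes the free orbits and there are points $\mathfrak q_1>\dots>\mathfrak q_k$ of $\mathbb R\cup\{\infty\}$ ($\infty$ counting as the largest) over which lie the fixed points, and coprime pairs $v_1,\dots,v_k\in\mathbb Z^2$ such that all points over the $\alpha$-th open boundary arc (from $\mathfrak q_{\alpha+1}$ to $\mathfrak q_\alpha$ for $\alpha<k$, and from $\mathfrak q_1$ through the remaining boundary to $\mathfrak q_k$ for $\alpha=k$) have stabilizer exactly $G(v_\alpha)$. The $v_\alpha$, listed in this cyclic order and each determined up to sign, are the stabilizer data of the action. A Riemannian metric $g$ on $M$ is called a Joyce metric (on $n\#\mathbb{CP}^2$; a manifold $M$ as follows is diffeomorphic to $n\#\mathbb{CP}^2$) if, for some $\mathbb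 Z$-basis of $\mathbb Z^2$, the pairs of coordinates of the $v_\alpha$ are, up to sign, pairs $(m_\alpha,n_\alpha)$ with $(m_1,n_1)=(0,1)$, $(m_k,n_k)=(1,0)$, $m_\alpha n_{\alpha+1}-m_{\alpha+1}n_\alpha=-1$ for $1\le\alpha<k$, and $m_\alpha,n_\alpha>0$ for $1<\alpha<k$, and if on the dense open set of free orbits, identified equivariantly (with respect to the isomorphism $T\cong \mathrm U(1)\times\mathrm U(1)$ given by that basis, up to the orientation of one angle) with $\mathcal H^2\times\mathrm U(1)\times\mathrm U(1)$ with coordinates $(x_1,x_2,y_1,y_2)$, $y_1,y_2$ of period $2\pi$, $g$ is conformal to $$\frac{dx_1^2+dx_2^2}{x_2^2}+\frac{(a_1^2+a_2^2)\,dy_1^2+(b_1^2+b_2^2)\,dy_2^2-2(a_1b_1+a_2b_2)\,dy_1dy_2}{(a_1b_2-a_2b_1)^2},$$ where $$\begin{pmatrix}a_1&b_1\\a_2&b_2\end{pmatrix}=\sum_{\alpha=1}^{k-1}\frac{u^{(\mathfrak q_\alpha)}-u^{(\mathfrak q_{\alpha+1})}}2\otimes(m_\alpha,n_\alpha)+\frac{u^{(\mathfrak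 q_k)}+u^{(\mathfrak q_1)}}2\otimes(m_k,n_k),$$ $u^{(\infty)}=\binom{0}{-1}$ and $u^{(\mathfrak q)}=\frac1{\sqrt{(x_1-\mathfrak q)^2+x_2^2}}\binom{x_2}{x_1-\mathfrak q}$ for $\mathfrak q\in\mathbb R$. **Proposition.** Let $g$ be a Joyce metric on $M$ with stabilizer data $v_1,\dots,v_k$. Suppose that some $\mathrm U(1)$-subgroup of $T$ (a subgroup isomorphic to $\mathrm U(1)$ as a topological group) acts semi-freely on $M$, that is, its action is non-trivial and each of its isotropy subgroups is either trivial or the whole subgroup. Then the stabilizer data can be normalized to $$(m_1,n_1)=(0,1),\qquad (m_\alpha,n_\alpha)=(1,k-\alpha)\quad(2\le\alpha\le k):$$ after a cyclic shift of the labels, a change of the $\mathbb Z$-basis of $\mathbb Z^2$, and changes of signs of the individual pairs, $v_\alpha$ becomes $(m_\alpha,n_\alpha)$ for all $\alpha$. -/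

import Mathlib

open scoped Manifold ContDiff

noncomputable section

namespace JoyceToric

/-- The torus `U(1) × U(1)`. -/
abbrev Torus : Type := Circle × Circle

/-- The subgroup `G(m, n) = {(z, w) | z ^ m * w ^ n = 1}` of the torus, for `v = (m, n)`. -/
def subgroupG (v : ℤ × ℤ) : Subgroup Torus where
  carrier := {t | t.1 ^ v.1 * t.2 ^ v.2 = 1}
  one_mem' := by simp
  mul_mem' := by
    intro s t hs ht
    simp only [Set.mem_ofPred_eq, Prod.fst_mul, Prod.snd_mul, mul_zpow] at *
    rw [mul_mul_mul_comm, hs, ht, one_mul]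
  inv_mem' := by
    intro t ht
    simp only [Set.mem_ofPred_eq, Prod.fst_inv, Prod.snd_inv, inv_zpow] at *
    rw [← mul_inv, ht, inv_one]

/-- A `U(1)`-subgroup of the torus: a subgroup isomorphic to the circle as a topological group. -/
def IsCircleSubgroup (K : Subgroup Torus) : Prop :=
  Nonempty (K ≃ₜ* Circle)

/-- A semi-free action: it is non-trivial, and every isotropy subgroup is everything or trivial. -/
def IsSemiFree (G X : Type*) [Group G] [MulAction G X] : Prop :=
  (∃ (a : G) (x : X), a • x ≠ x) ∧
    ∀ x : X, MulAction.stabilizer G x = ⊤ ∨ MulAction.stabilizer G x = ⊥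

/-! ### The orbit space and the stabilizer data

The orbit space is the closed disc, in the form of the closed upper half plane together with the
point at infinity, inside the Riemann sphere `OnePoint ℂ`.  Its boundary circle `ℝ ∪ {∞}` is
`WithTop ℝ`. -/

/-- The inclusion of the boundary circle `ℝ ∪ {∞}` into the Riemann sphere. -/
def bdryPoint : WithTop ℝ → OnePoint ℂ
  | ⊤ => OnePoint.infty
  | (x : ℝ) => ((x : ℂ) : OnePoint ℂ)

/-- For `q 0 > q 1 > ⋯ > q (n+1)` on the boundary circle, `b` lies on the open arc with index `α`:
between `q (α+1)` and `q α` if `α ≤ n`, and between `q 0` and `q (n+1)`, on the remaining side,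
if `α = n+1`. -/
def OnArc {n : ℕ} (q : Fin (n + 2) → WithTop ℝ) (α : Fin (n + 2)) (b : WithTop ℝ) : Prop :=
  (∃ i : Fin (n + 1), α = i.castSucc ∧ q i.succ < b ∧ b < q i.castSucc) ∨
    (α = Fin.last (n + 1) ∧ (b < q (Fin.last (n + 1)) ∨ q 0 < b))

/-- The action of the torus on `M` has the stabilizer data `v` (with `k = n + 2` members, listed in
cyclic order).  Here `π` is the orbit map onto the closed disc; the interior of the disc consists
of the free orbits, the preimage of the `α`-th closed boundary arc is the invariant two-sphere
with stabilizer `G(v α)`, and the vertices `q α` are the fixed points, where two adjacent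
two-spheres meet. -/
structure HasStabilizerData {n : ℕ} {M : Type*} [TopologicalSpace M] [MulAction Torus M]
    (π : M → OnePoint ℂ) (q : Fin (n + 2) → WithTop ℝ) (v : Fin (n + 2) → ℤ × ℤ) : Prop where
  continuous : Continuous π
  range_eq : Set.range π = insert OnePoint.infty ((fun z : ℂ => (z : OnePoint ℂ)) '' {z | 0 ≤ z.im})
  fiber_iff : ∀ p p' : M, π p = π p' ↔ ∃ t : Torus, t • p = p'
  strictAnti : StrictAnti q
  coprime : ∀ α, IsCoprime (v α).1 (v α).2
  stabilizer_interior : ∀ (p : M) (z : ℂ), 0 < z.im → π p = (z : OnePoint ℂ) →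
    MulAction.stabilizer Torus p = ⊥
  stabilizer_arc : ∀ (α : Fin (n + 2)) (b : WithTop ℝ), OnArc q α b →
    ∀ p : M, π p = bdryPoint b → MulAction.stabilizer Torus p = subgroupG (v α)
  stabilizer_vertex : ∀ (α : Fin (n + 2)) (p : M), π p = bdryPoint (q α) →
    MulAction.stabilizer Torus p = ⊤

/-- The normal form of stabilizer data in which the Joyce metric is written down:
`(m₁, n₁) = (0, 1)`, `(m_k, n_k) = (1, 0)`, `m_α n_{α+1} - m_{α+1} n_α = -1`, and
`m_α, n_α > 0` for `1 < α < k`. -/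
structure IsNormalized {n : ℕ} (w : Fin (n + 2) → ℤ × ℤ) : Prop where
  first : w 0 = (0, 1)
  last : w (Fin.last (n + 1)) = (1, 0)
  det_eq : ∀ i : Fin (n + 1),
    (w i.castSucc).1 * (w i.succ).2 - (w i.succ).1 * (w i.castSucc).2 = -1
  pos : ∀ α, α ≠ 0 → α ≠ Fin.last (n + 1) → 0 < (w α).1 ∧ 0 < (w α).2

/-! ### The Joyce metric -/

/-- The `ℝ²`-valued function `u^{(q)}` on the upper half plane, `q ∈ ℝ ∪ {∞}`. -/
def u : WithTop ℝ → ℝ → ℝ → ℝ × ℝ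
  | ⊤, _, _ => (0, -1)
  | (q : ℝ), x₁, x₂ =>
      (x₂ / Real.sqrt ((x₁ - q) ^ 2 + x₂ ^ 2), (x₁ - q) / Real.sqrt ((x₁ - q) ^ 2 + x₂ ^ 2))

/-- A column of the matrix `φ = ∑_{α<k} (u^{(q_α)} - u^{(q_{α+1})})/2 ⊗ (m_α, n_α)
+ (u^{(q_k)} + u^{(q_1)})/2 ⊗ (m_k, n_k)`: the first column `(a₁, a₂)` for `c = m`, the second
column `(b₁, b₂)` for `c = n`. -/
def phiColumn {n : ℕ} (q : Fin (n + 2) → WithTop ℝ) (c : Fin (n + 2) → ℤ) (x₁ x₂ : ℝ) : ℝ × ℝ :=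
  (∑ i : Fin (n + 1), ((c i.castSucc : ℝ) / 2) • (u (q i.castSucc) x₁ x₂ - u (q i.succ) x₁ x₂))
    + ((c (Fin.last (n + 1)) : ℝ) / 2) • (u (q (Fin.last (n + 1))) x₁ x₂ + u (q 0) x₁ x₂)

/-- The Joyce metric, in the coordinates `x = (x₁, x₂, y₁, y₂)` with `x₂ > 0`, as a bilinear form
in the tangent vectors `s`, `t`:
`(dx₁² + dx₂²)/x₂² + ((a₁²+a₂²)dy₁² + (b₁²+b₂²)dy₂² - 2(a₁b₁+a₂b₂)dy₁dy₂)/(a₁b₂-a₂b₁)²`. -/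
def joyceForm {n : ℕ} (q : Fin (n + 2) → WithTop ℝ) (w : Fin (n + 2) → ℤ × ℤ)
    (x s t : EuclideanSpace ℝ (Fin 4)) : ℝ :=
  let a := phiColumn q (fun α => (w α).1) (x 0) (x 1)
  let b := phiColumn q (fun α => (w α).2) (x 0) (x 1)
  (s 0 * t 0 + s 1 * t 1) / (x 1) ^ 2 +
    ((a.1 ^ 2 + a.2 ^ 2) * (s 2 * t 2) + (b.1 ^ 2 + b.2 ^ 2) * (s 3 * t 3)
      - (a.1 * b.1 + a.2 * b.2) * (s 2 * t 3 + s 3 * t 2)) / (a.1 * b.2 - a.2 * b.1) ^ 2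

/-- The domain `x₂ > 0` of the coordinates `(x₁, x₂, y₁, y₂)`. -/
def coordDomain : Set (EuclideanSpace ℝ (Fin 4)) := {x | 0 < x 1}

/-- The pairing of a character of the torus with a vector of angles. -/
def pairing (f : ℤ × ℤ) (θ : ℝ × ℝ) : ℝ := f.1 * θ.1 + f.2 * θ.2

/-- A smooth Riemannian metric on a four-manifold. -/
abbrev RiemMetric (M : Type*) [TopologicalSpace M] [ChartedSpace (EuclideanSpace ℝ (Fin 4)) M]
    [IsManifold (𝓡 4) ∞ M] : Type _ :=
  Bundle.ContMDiffRiemannianMetric (𝓡 4) ∞ (EuclideanSpace ℝ (Fin 4))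
    (fun x : M => TangentSpace (𝓡 4) x)

/-- `g` is (a representative of the conformal class of) a Joyce metric for the given torus action
on `M`, and the stabilizer data of this action are `v`, with `k = n + 2` members.

After a change of the `ℤ`-basis of the character lattice `ℤ²` (the automorphism `e`) and changes of
sign the data are in the normal form `w`.  The map `Ψ` gives the coordinates `(x₁, x₂, y₁, y₂)`,
with `y₁`, `y₂` of period `2π`, on the dense open set of free orbits, a copy of
(upper half plane) × `U(1) × U(1)`, and in these coordinates `g` is conformal to the Joyce metric of
`q` and `w`.  In the `ℤ`-basis `e⁻¹(1,0)`, `e⁻¹(0,1)` of characters a torus element with angles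
`(ζ₁, ζ₂)` translates `(y₁, y₂)` by `(ζ₁, -ζ₂)`; with this orientation of `y₂` the circle that
`joyceForm` collapses on the arc with label `(m, n)` is the one of `G(m, n)`. -/
def IsJoyceMetric {n : ℕ} {M : Type*} [TopologicalSpace M]
    [ChartedSpace (EuclideanSpace ℝ (Fin 4)) M] [IsManifold (𝓡 4) ∞ M] [MulAction Torus M]
    (g : RiemMetric M) (v : Fin (n + 2) → ℤ × ℤ) : Prop :=
  ∃ (π : M → OnePoint ℂ) (q : Fin (n + 2) → WithTop ℝ) (w : Fin (n + 2) → ℤ × ℤ)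
    (e : (ℤ × ℤ) ≃+ (ℤ × ℤ)) (Ψ : EuclideanSpace ℝ (Fin 4) → M),
    HasStabilizerData π q v ∧
    IsNormalized w ∧
    (∀ α, e (v α) = w α ∨ e (v α) = -w α) ∧
    ContMDiffOn (𝓡 4) (𝓡 4) ∞ Ψ coordDomain ∧
    Dense (Ψ '' coordDomain) ∧
    (∀ x ∈ coordDomain, π (Ψ x) = ((⟨x 0, x 1⟩ : ℂ) : OnePoint ℂ)) ∧
    (∀ x ∈ coordDomain, ∀ θ : ℝ × ℝ,
      ((Circle.exp θ.1, Circle.exp θ.2) : Torus) • Ψ x =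
        Ψ (x + !₂[0, 0, pairing (e.symm (1, 0)) θ, -pairing (e.symm (0, 1)) θ])) ∧
    (∀ x ∈ coordDomain, ∃ c : ℝ, 0 < c ∧ ∀ s t : EuclideanSpace ℝ (Fin 4),
      g.inner (Ψ x) (mfderiv (𝓡 4) (𝓡 4) Ψ x s) (mfderiv (𝓡 4) (𝓡 4) Ψ x t) =
        c * joyceForm q w x s t)

/-- The stabilizer data `v` can be normalized to `w`: the two agree after a cyclic shift of the
labels, a change of the `ℤ`-basis of `ℤ²`, and changes of the signs of the pairs (`G(-m, -n)` and
`G(m, n)` are equal). -/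
def NormalizesTo {n : ℕ} (v w : Fin (n + 2) → ℤ × ℤ) : Prop :=
  ∃ (c : Fin (n + 2)) (e : (ℤ × ℤ) ≃+ (ℤ × ℤ)),
    ∀ α, e (v (c + α)) = w α ∨ e (v (c + α)) = -w α

end JoyceToric

end

/-!
The metric enters only through the normal form of the stabilizer data `w`.

A circle subgroup `K` of the torus is `{(z ^ a, z ^ b)}` with `(a, b) ≠ 0`, because continuous
endomorphisms of the circle are powers (`Circle.exists_eq_zpow_of_continuous`).  It meets the
stabilizer `G(m, n)` in the elements with `z ^ (a m + b n) = 1`.  Every `G(v α)` is an isotropy group,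
so a semi-free `K` forces `a m + b n ∈ {0, 1, -1}` for every `(m, n) = v α`
(`IsSemiFree.exists_weights`).  Transported to the normal form, this is a non-zero functional
`λ = (a, b)` on `ℤ²` that takes values in `{0, 1, -1}` on all the `w α`.

Since `(0, 1)` and `(1, 0)` are among the `w α`, both `a` and `b` are in `{0, 1, -1}`.  Up to the sign
of `λ`, which does not matter, four functionals remain, and the determinant condition on consecutive
pairs then determines the data.
* `λ = m`: the pairs are `(0, 1), (1, n), …, (1, 0)`, the required list.
* `λ = n`: the pairs are `(0, 1), (1, 1), …, (n, 1), (1, 0)`, the required list up to a shift and a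
  change of basis.
* `λ = m - n`: if there are more than two pairs, they are
  `(0, 1), …, (p - 1, p), (1, 1), (r + 1, r), …, (1, 0)`
  (`exists_profile_of_abs_sub_le_one`).  Starting from `(1, 1)`, in a basis with first coordinate
  `m - n`, one finds again the required list.
* `λ = m + n`: this is at least `2` at all pairs except the two end ones, so there are only these two.
-/

/-! ### Characters of the circle -/

/-- A continuous endomorphism of the circle is `z ↦ z ^ d` for some integer `d`.  Some Fourier
coefficient of the endomorphism is non-zero, and that coefficient is the integral of a character of
the circle; a character whose integral is non-zero is trivial, by invariance of Haar measure. -/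
theorem Circle.exists_eq_zpow_of_continuous (f : Circle →* Circle) (hf : Continuous f) :
    ∃ d : ℤ, ∀ z, f z = z ^ d := by
  have : Fact (0 < 2 * Real.pi) := ⟨Real.two_pi_pos⟩
  let F : C(AddCircle (2 * Real.pi), ℂ) :=
    ⟨fun x => (f x.toCircle : ℂ), by
      have := AddCircle.continuous_toCircle (T := 2 * Real.pi)
      fun_prop⟩
  have hF : ∀ x, F x = (f x.toCircle : ℂ) := fun _ => rfl
  obtain ⟨d, hd⟩ : ∃ d : ℤ, fourierCoeff F d ≠ 0 := by
    by_contra! h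
    have hs : Summable (fourierCoeff F) := by
      rw [show fourierCoeff F = 0 from funext h]
      exact summable_zero
    have h0 := has_pointwise_sum_fourier_series_of_summable hs 0
    simp only [h, zero_smul] at h0
    have h1 := h0.unique hasSum_zero
    simp [hF] at h1
  refine ⟨d, fun z => ?_⟩
  obtain ⟨y, rfl⟩ : ∃ y : AddCircle (2 * Real.pi), y.toCircle = z :=
    ⟨((z : ℂ).arg : ℝ), by rw [AddCircle.toCircle_apply_mk]; simp [Circle.exp_arg]⟩
  let χ : AddCircle (2 * Real.pi) → ℂ := fun x => fourier (-d) x • F x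
  have hχ : ∀ x, χ (y + x) = χ y * χ x := by
    intro x
    simp only [χ, hF, fourier_apply, smul_eq_mul, smul_add, AddCircle.toCircle_add, map_mul,
      Circle.coe_mul]
    ring
  have hint : χ y * fourierCoeff F d = fourierCoeff F d := by
    calc χ y * fourierCoeff F d = ∫ x, χ (y + x) ∂AddCircle.haarAddCircle := by
          simp only [hχ]
          rw [MeasureTheory.integral_const_mul]
          rfl
      _ = fourierCoeff F d := MeasureTheory.integral_add_left_eq_self χ y
  have hone : χ y = 1 := mul_right_cancel₀ hd (by rw [hint, one_mul])
  have hcirc : y.toCircle ^ (-d) * f y.toCircle = 1 := by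
    apply Circle.ext
    rw [← AddCircle.toCircle_zsmul]
    simpa [χ, hF, fourier_apply] using hone
  rw [zpow_neg, inv_mul_eq_one] at hcirc
  exact hcirc.symm

/-! ### Weights of a semi-free circle subgroup -/

namespace JoyceToric

/-- The circle `{(z ^ a, z ^ b)}` meets `G(v)` in the group of `c`-th roots of unity, where
`c = a * v.1 + b * v.2`. -/
theorem abs_weight_le_one_of_subgroupOf_eq {K : Subgroup Torus} {a b : ℤ} (f : Circle → K)
    (hf : Function.Bijective f) (hab : ∀ z, (f z : Torus) = (z ^ a, z ^ b)) {v : ℤ × ℤ}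
    (h : (subgroupG v).subgroupOf K = ⊤ ∨ (subgroupG v).subgroupOf K = ⊥) :
    |a * v.1 + b * v.2| ≤ 1 := by
  set c := a * v.1 + b * v.2 with hc
  have hmem : ∀ z, f z ∈ (subgroupG v).subgroupOf K ↔ z ^ c = 1 := by
    intro z
    rw [Subgroup.mem_subgroupOf, hab]
    change (z ^ a) ^ v.1 * (z ^ b) ^ v.2 = 1 ↔ _
    rw [← zpow_mul, ← zpow_mul, ← zpow_add]
  have hexp : ∀ t : ℝ, Circle.exp t ^ c = Circle.exp (c * t) := fun t => by
    rw [← zsmul_eq_mul, Circle.exp_zsmul]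
  have hf1 : f 1 = 1 := by
    apply Subtype.ext
    rw [hab]
    simp
  by_cases hc0 : c = 0
  · simp [hc0]
  have hcR : (c : ℝ) ≠ 0 := by exact_mod_cast hc0
  rcases h with h | h
  · -- the element of the circle whose `c`-th power is `exp 1 ≠ 1` lies outside `G(v)`
    have h1 := (hmem (Circle.exp (1 / c))).1 (h ▸ Subgroup.mem_top _)
    rw [hexp, mul_one_div_cancel hcR, Circle.exp_eq_one] at h1
    obtain ⟨m, hm⟩ := h1
    have hpi := Real.pi_gt_three
    rcases le_or_gt m 0 with h0 | h0
    · have : (m : ℝ) ≤ 0 := by exact_mod_cast h0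
      nlinarith
    · have : (1 : ℝ) ≤ m := by exact_mod_cast h0
      nlinarith
  · -- a primitive `|c|`-th root of unity is trivial
    have h1 := (hmem (Circle.exp (2 * Real.pi / c))).2 (by
      rw [hexp, mul_div_cancel₀ _ hcR, Circle.exp_two_pi])
    rw [h, Subgroup.mem_bot, ← hf1] at h1
    have h2 := hf.injective h1
    rw [Circle.exp_eq_one] at h2
    obtain ⟨m, hm⟩ := h2
    have hmc : m * c = 1 := by
      have : (m : ℝ) * c = 1 := by
        field_simp at hm
        linarith
      exact_mod_cast this
    have : IsUnit c := IsUnit.of_mul_eq_one m (by rw [mul_comm]; exact hmc)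
    rw [Int.isUnit_iff_abs_eq.1 this]

theorem IsCircleSubgroup.exists_weights {K : Subgroup Torus} (hK : IsCircleSubgroup K) :
    ∃ (a b : ℤ) (f : Circle → K), Function.Bijective f ∧
      (∀ z, (f z : Torus) = (z ^ a, z ^ b)) ∧ (a ≠ 0 ∨ b ≠ 0) := by
  obtain ⟨φ⟩ := hK
  have hφ : Continuous φ.symm := φ.symm.continuous
  obtain ⟨a, ha⟩ := Circle.exists_eq_zpow_of_continuous
    ((MonoidHom.fst Circle Circle).comp (K.subtype.comp φ.symm.toMonoidHom))
    (continuous_fst.comp (continuous_subtype_val.comp hφ))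
  obtain ⟨b, hb⟩ := Circle.exists_eq_zpow_of_continuous
    ((MonoidHom.snd Circle Circle).comp (K.subtype.comp φ.symm.toMonoidHom))
    (continuous_snd.comp (continuous_subtype_val.comp hφ))
  have hab : ∀ z, (φ.symm z : Torus) = (z ^ a, z ^ b) := fun z => Prod.ext (ha z) (hb z)
  refine ⟨a, b, φ.symm, φ.symm.bijective, hab, ?_⟩
  -- two zero weights would make `φ.symm` constant, although `exp π = -1 ≠ 1`
  by_contra! h0
  have h1 : φ.symm (Circle.exp Real.pi) = φ.symm 1 := by
    apply Subtype.ext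
    rw [hab, hab, h0.1, h0.2]
    simp
  have h2 := congrArg (fun z : Circle => (z : ℂ)) (φ.symm.injective h1)
  norm_num [Circle.coe_exp] at h2

/-- Every boundary arc is non-empty, and every point of it is in the image of the orbit map. -/
theorem HasStabilizerData.exists_stabilizer_eq {n : ℕ} {M : Type*} [TopologicalSpace M]
    [MulAction Torus M] {π : M → OnePoint ℂ} {q : Fin (n + 2) → WithTop ℝ}
    {v : Fin (n + 2) → ℤ × ℤ} (h : HasStabilizerData π q v) (α : Fin (n + 2)) :
    ∃ p : M, MulAction.stabilizer Torus p = subgroupG (v α) := by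
  have hne : ∀ β : Fin (n + 2), β ≠ 0 → ∃ r : ℝ, q β = r := by
    intro β hβ
    have : q β < q 0 := h.strictAnti (Fin.pos_of_ne_zero hβ)
    obtain ⟨r, hr⟩ := WithTop.ne_top_iff_exists.1 this.ne_top
    exact ⟨r, hr.symm⟩
  obtain ⟨r, hr⟩ : ∃ r : ℝ, OnArc q α r := by
    induction α using Fin.lastCases with
    | last =>
      obtain ⟨s, hs⟩ := hne (Fin.last (n + 1)) (Fin.last_pos).ne'
      refine ⟨s - 1, Or.inr ⟨rfl, Or.inl ?_⟩⟩
      rw [hs, WithTop.coe_lt_coe]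
      linarith
    | cast i =>
      obtain ⟨s, hs⟩ := hne i.succ (Fin.succ_ne_zero i)
      have hlt : q i.succ < q i.castSucc := h.strictAnti Fin.castSucc_lt_succ
      obtain ⟨t, ht1, ht2⟩ : ∃ t : ℝ, s < t ∧ (t : WithTop ℝ) < q i.castSucc := by
        cases hq : q i.castSucc with
        | top => exact ⟨s + 1, by linarith, WithTop.coe_lt_top _⟩
        | coe r =>
          rw [hq, hs, WithTop.coe_lt_coe] at hlt
          obtain ⟨t, h1, h2⟩ := exists_between hlt
          exact ⟨t, h1, WithTop.coe_lt_coe.2 h2⟩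
      exact ⟨t, Or.inl ⟨i, rfl, by rw [hs, WithTop.coe_lt_coe]; exact ht1, ht2⟩⟩
  have hmem : bdryPoint r ∈ Set.range π := by
    rw [h.range_eq]
    exact Or.inr ⟨(r : ℂ), by simp, rfl⟩
  obtain ⟨p, hp⟩ := hmem
  exact ⟨p, h.stabilizer_arc α r hr p hp⟩

theorem IsSemiFree.exists_weights {n : ℕ} {M : Type*} [TopologicalSpace M]
    [MulAction Torus M] {π : M → OnePoint ℂ} {q : Fin (n + 2) → WithTop ℝ}
    {v : Fin (n + 2) → ℤ × ℤ} (h : HasStabilizerData π q v) {K : Subgroup Torus}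
    (hK : IsCircleSubgroup K) (hfree : IsSemiFree K M) :
    ∃ a b : ℤ, (a ≠ 0 ∨ b ≠ 0) ∧ ∀ α, |a * (v α).1 + b * (v α).2| ≤ 1 := by
  obtain ⟨a, b, f, hf, hab, hne⟩ := hK.exists_weights
  refine ⟨a, b, hne, fun α => ?_⟩
  obtain ⟨p, hp⟩ := h.exists_stabilizer_eq α
  have hstab : MulAction.stabilizer K p = (subgroupG (v α)).subgroupOf K := by
    rw [← hp]
    rfl
  exact abs_weight_le_one_of_subgroupOf_eq f hf hab (hstab ▸ hfree.2 p)

/-! ### Changes of basis and cyclic shifts -/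

/-- The pairs `(0, 1)` and `(1, k - α)` for `2 ≤ α ≤ k = n + 2`, with labels starting at `0`. -/
def semiFreeData (n : ℕ) (α : Fin (n + 2)) : ℤ × ℤ :=
  if α = 0 then (0, 1) else (1, ((n : ℤ) + 2) - ((α : ℕ) + 1))

theorem semiFreeData_mk_of_pos {n j : ℕ} (hj : j < n + 2) (h0 : 0 < j) :
    semiFreeData n ⟨j, hj⟩ = (1, (n : ℤ) + 1 - j) := by
  rw [semiFreeData, if_neg (by simpa [Fin.ext_iff] using h0.ne')]
  ext
  · rfl
  · ring

/-- The automorphism `(x, y) ↦ (y, p y - x)` of `ℤ²`. -/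
def latticeRotation (p : ℤ) : (ℤ × ℤ) ≃+ (ℤ × ℤ) where
  toFun x := (x.2, p * x.2 - x.1)
  invFun x := (p * x.1 - x.2, x.1)
  left_inv x := by ext <;> simp
  right_inv x := by ext <;> simp
  map_add' x y := by ext <;> simp; ring

/-- The automorphism `(x, y) ↦ (x - y, y + p (x - y))` of `ℤ²`. -/
def latticeShear (p : ℤ) : (ℤ × ℤ) ≃+ (ℤ × ℤ) where
  toFun x := (x.1 - x.2, x.2 + p * (x.1 - x.2))
  invFun x := (x.1 + (x.2 - p * x.1), x.2 - p * x.1)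
  left_inv x := by ext <;> simp
  right_inv x := by ext <;> simp
  map_add' x y := by ext <;> simp <;> ring

/-- Normalization in terms of an enumeration of the data by natural numbers, which turns the cyclic
shift of `Fin (n + 2)` into addition modulo `n + 2`. -/
theorem normalizesTo_of_forall_lt {n : ℕ} {w w' : Fin (n + 2) → ℤ × ℤ} (W : ℕ → ℤ × ℤ)
    (hW : ∀ α : Fin (n + 2), w α = W α) (p : ℕ) (hp : p < n + 2) (e : (ℤ × ℤ) ≃+ (ℤ × ℤ))
    (h₁ : ∀ (j : ℕ) (hj : p + j < n + 2),
      e (W (p + j)) = w' ⟨j, by lia⟩ ∨ e (W (p + j)) = -w' ⟨j, by lia⟩)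
    (h₂ : ∀ (j : ℕ) (hj : j < p),
      e (W j) = w' ⟨n + 2 - p + j, by lia⟩ ∨ e (W j) = -w' ⟨n + 2 - p + j, by lia⟩) :
    NormalizesTo w w' := by
  refine ⟨⟨p, hp⟩, e, fun α => ?_⟩
  rw [hW, Fin.val_add]
  by_cases hlt : p + (α : ℕ) < n + 2
  · have := h₁ α hlt
    simpa [Nat.mod_eq_of_lt hlt] using this
  · have hα := α.isLt
    have hmod : (p + (α : ℕ)) % (n + 2) = p + α - (n + 2) := by
      rw [Nat.mod_eq_sub_mod (by lia), Nat.mod_eq_of_lt (by lia)]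
    have := h₂ (p + α - (n + 2)) (by lia)
    have hval : n + 2 - p + (p + (α : ℕ) - (n + 2)) = α := by lia
    simp only [hval] at this
    simpa [hmod] using this

theorem IsNormalized.exists_enumeration {n : ℕ} {w : Fin (n + 2) → ℤ × ℤ} (hw : IsNormalized w) :
    ∃ W : ℕ → ℤ × ℤ, (∀ α : Fin (n + 2), w α = W α) ∧ W 0 = (0, 1) ∧ W (n + 1) = (1, 0) ∧
      (∀ j < n + 1, (W j).1 * (W (j + 1)).2 - (W (j + 1)).1 * (W j).2 = -1) ∧
      ∀ j, 0 < j → j < n + 1 → 0 < (W j).1 ∧ 0 < (W j).2 := by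
  have hval : ∀ (j : ℕ) (hj : j < n + 2), Fin.ofNat (n + 2) j = ⟨j, hj⟩ := fun j hj =>
    Fin.ext (Nat.mod_eq_of_lt hj)
  refine ⟨fun j => w (Fin.ofNat (n + 2) j), fun α => ?_, ?_, ?_, ?_, ?_⟩
  · simp only [hval α α.isLt]
  · simp only [hval 0 (by lia)]
    exact hw.first
  · simp only [hval (n + 1) (by lia)]
    exact hw.last
  · intro j hj
    simp only [hval j (by lia), hval (j + 1) (by lia)]
    exact hw.det_eq ⟨j, hj⟩
  · intro j h0 hj
    simp only [hval j (by lia)]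
    refine hw.pos _ ?_ ?_ <;> rw [Ne, Fin.ext_iff] <;> simp <;> lia

/-! ### Normalized data on which a functional is bounded by one -/

theorem normalizesTo_of_fst_le_one {n : ℕ} {w : Fin (n + 2) → ℤ × ℤ} (hw : IsNormalized w)
    (h : ∀ α, |(w α).1| ≤ 1) : NormalizesTo w (semiFreeData n) := by
  obtain ⟨W, hWw, hW0, hWl, hdet, hpos⟩ := hw.exists_enumeration
  have h' : ∀ j < n + 2, (W j).1 ≤ 1 := fun j hj => by
    have := h ⟨j, hj⟩
    rw [hWw, abs_le] at this
    exact this.2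
  have h1 : ∀ j, 0 < j → j < n + 2 → (W j).1 = 1 := by
    intro j h0 hj
    rcases Nat.lt_succ_iff_lt_or_eq.1 hj with hlt | rfl
    · have := hpos j h0 hlt
      have := h' j hj
      lia
    · rw [hWl]
  -- only the last pair `(1, 0)` is known, so the second coordinates are found backwards from it
  have h2 : ∀ i, i < n + 1 → W (n + 1 - i) = (1, (i : ℤ)) := by
    intro i
    induction i with
    | zero => intro _; simpa using hWl
    | succ i ih =>
      intro hi
      have hd := hdet (n + 1 - (i + 1)) (by lia)
      rw [show n + 1 - (i + 1) + 1 = n + 1 - i by lia, ih (by lia),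
        h1 _ (by lia) (by lia)] at hd
      have hd' : (W (n + 1 - (i + 1))).2 = (i : ℤ) + 1 := by linarith
      exact Prod.ext (h1 _ (by lia) (by lia)) (by rw [hd', Nat.cast_succ])
  refine normalizesTo_of_forall_lt W hWw 0 (by lia) (AddEquiv.refl _) (fun j hj => Or.inl ?_)
    (fun j hj => absurd hj (by lia))
  rw [zero_add] at hj ⊢
  rcases Nat.eq_zero_or_pos j with rfl | h0
  · simpa [semiFreeData] using hW0
  · have hj' := h2 (n + 1 - j) (by lia)
    rw [show n + 1 - (n + 1 - j) = j by lia] at hj'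
    rw [semiFreeData_mk_of_pos (by lia) h0]
    simp only [AddEquiv.refl_apply, hj']
    ext
    · rfl
    · push_cast [show j ≤ n + 1 by lia]
      ring

theorem normalizesTo_of_snd_le_one {n : ℕ} {w : Fin (n + 2) → ℤ × ℤ} (hw : IsNormalized w)
    (h : ∀ α, |(w α).2| ≤ 1) : NormalizesTo w (semiFreeData n) := by
  obtain ⟨W, hWw, hW0, hWl, hdet, hpos⟩ := hw.exists_enumeration
  have h' : ∀ j < n + 2, (W j).2 ≤ 1 := fun j hj => by
    have := h ⟨j, hj⟩
    rw [hWw, abs_le] at this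
    exact this.2
  have h1 : ∀ j, j < n + 1 → (W j).2 = 1 := by
    intro j hj
    rcases Nat.eq_zero_or_pos j with rfl | h0
    · rw [hW0]
    · have := hpos j h0 hj
      have := h' j (by lia)
      lia
  have h2 : ∀ i, i < n + 1 → W i = ((i : ℤ), 1) := by
    intro i
    induction i with
    | zero => intro _; simpa using hW0
    | succ i ih =>
      intro hi
      have hd := hdet i (by lia)
      rw [ih (by lia), h1 _ hi] at hd
      exact Prod.ext (by push_cast; linarith) (h1 _ hi)
  -- the label of `(1, 0)` becomes the first one
  refine normalizesTo_of_forall_lt W hWw (n + 1) (by lia) (latticeRotation n)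
    (fun j hj => Or.inr ?_) (fun j hj => Or.inl ?_)
  · obtain rfl : j = 0 := by lia
    simp [hWl, semiFreeData, latticeRotation]
  · rw [semiFreeData_mk_of_pos (by lia) (by lia)]
    simp only [h2 j hj]
    ext
    · rfl
    · simp only [latticeRotation, AddEquiv.coe_mk, Equiv.coe_fn_mk]
      rw [show n + 2 - (n + 1) + j = j + 1 by lia]
      push_cast
      ring

/-- If the coordinates of every pair of normalized data differ by at most one, the data run through
`(0, 1), (1, 2), …, (p - 1, p)`, then `(1, 1)`, then `(r + 1, r), …, (2, 1), (1, 0)`. -/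
theorem exists_profile_of_abs_sub_le_one {n : ℕ} (hn : 0 < n) {W : ℕ → ℤ × ℤ}
    (hW0 : W 0 = (0, 1)) (hWl : W (n + 1) = (1, 0))
    (hdet : ∀ j < n + 1, (W j).1 * (W (j + 1)).2 - (W (j + 1)).1 * (W j).2 = -1)
    (hpos : ∀ j, 0 < j → j < n + 1 → 0 < (W j).1 ∧ 0 < (W j).2)
    (h : ∀ j < n + 2, |(W j).1 - (W j).2| ≤ 1) :
    ∃ p < n + 1, (∀ j < p, W j = ((j : ℤ), (j : ℤ) + 1)) ∧ W p = (1, 1) ∧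
      ∀ j, p < j → j < n + 2 → W j = ((n : ℤ) + 2 - j, (n : ℤ) + 1 - j) := by
  have hex : ∃ j, W j ≠ ((j : ℤ), (j : ℤ) + 1) := ⟨n + 1, by
    rw [hWl, Ne, Prod.ext_iff]
    push_cast
    lia⟩
  classical
  obtain ⟨p, hpW, hlt⟩ : ∃ p, W p ≠ ((p : ℤ), (p : ℤ) + 1) ∧
      ∀ j < p, W j = ((j : ℤ), (j : ℤ) + 1) :=
    ⟨Nat.find hex, Nat.find_spec hex, fun j hj => not_not.1 (Nat.find_min hex hj)⟩
  have hpn : p ≤ n + 1 := by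
    by_contra! hc
    have := hlt _ hc
    rw [hWl, Prod.ext_iff] at this
    push_cast at this
    lia
  have hp0 : p ≠ 0 := by
    rintro rfl
    exact hpW (by simpa using hW0)
  have hp : W p = (1, 1) := by
    obtain ⟨i, rfl⟩ := Nat.exists_eq_succ_of_ne_zero hp0
    have hd := hdet i (by lia)
    rw [hlt i (by lia)] at hd
    have hc := abs_le.1 (h (i + 1) (by lia))
    rw [Nat.succ_eq_add_one] at hpW ⊢
    have hn0 : 0 ≤ (W (i + 1)).2 ∧ ((W (i + 1)).2 = 0 → i = n) := by
      rcases hpn.lt_or_eq with hlt | heq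
      · have := hpos (i + 1) (by lia) hlt
        lia
      · have : i = n := by lia
        subst this
        rw [hWl]
        simp
    generalize W (i + 1) = x at hd hc hpW hn0 ⊢
    obtain ⟨x, y⟩ := x
    simp only at hd hc hn0
    obtain rfl | rfl | rfl : y = x + 1 ∨ y = x ∨ x = y + 1 := by lia
    · refine absurd ?_ hpW
      have : x = i + 1 := by linarith
      ext <;> simp <;> lia
    · have : y = 1 := by linarith
      rw [this]
    · -- from `(i, i + 1)` to `(y + 1, y)` only if `i = y = 0`, which needs `n = 0`
      have : (i : ℤ) + y = 0 := by linarith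
      lia
  have hpn' : p < n + 1 := by
    refine lt_of_le_of_ne hpn ?_
    rintro rfl
    rw [hWl] at hp
    simp at hp
  refine ⟨p, hpn', hlt, hp, ?_⟩
  -- after `(1, 1)` the difference of the coordinates is `1`, and both go down by one at each step
  have hafter : ∀ i, p + 1 + i < n + 2 →
      W (p + 1 + i) = ((W (p + 1)).2 + 1 - i, (W (p + 1)).2 - i) := by
    intro i
    induction i with
    | zero =>
      intro _
      have hd := hdet p hpn'
      rw [hp] at hd
      ext
      · simp only [add_zero]
        push_cast
        linarith
      · simp
    | succ i ih =>
      intro hi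
      have hd := hdet (p + 1 + i) (by lia)
      have hposi := hpos (p + 1 + i) (by lia) (by lia)
      rw [ih (by lia)] at hd hposi
      have hc := abs_le.1 (h (p + 1 + i + 1) (by lia))
      have hn0 : 0 ≤ (W (p + 1 + i + 1)).2 ∧ 0 < (W (p + 1 + i + 1)).1 := by
        rcases (show p + 1 + i + 1 ≤ n + 1 by lia).lt_or_eq with hlt | heq
        · have := hpos (p + 1 + i + 1) (by lia) hlt
          lia
        · rw [heq, hWl]
          simp
      rw [← add_assoc]
      push_cast
      simp only at hd hposi
      have hs : 0 < (W (p + 1)).2 - (i : ℤ) := hposi.2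
      have h1 : (W (p + 1)).2 + 1 - (i : ℤ) = ((W (p + 1)).2 - i) + 1 := by ring
      rw [h1] at hd
      generalize W (p + 1 + i + 1) = x at hd hc hn0 ⊢
      obtain ⟨x, y⟩ := x
      simp only at hd hc hn0
      generalize hsd : (W (p + 1)).2 - (i : ℤ) = s at hd hs
      -- after `(s + 1, s)` with `s > 0`, only `x = y + 1` is compatible with determinant `-1`
      obtain rfl | rfl | rfl : y = x + 1 ∨ y = x ∨ x = y + 1 := by lia
      · nlinarith
      · nlinarith
      · have : y = s - 1 := by linarith
        ext <;> simp <;> lia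
  -- the last pair `(1, 0)` gives the value of the coordinates at `p + 1`
  have hr := hafter (n - p) (by lia)
  rw [show p + 1 + (n - p) = n + 1 by lia, hWl, Prod.ext_iff] at hr
  intro j hpj hj
  have hj' := hafter (j - (p + 1)) (by lia)
  rw [show p + 1 + (j - (p + 1)) = j by lia] at hj'
  rw [hj']
  simp only at hr
  ext <;> simp <;> lia

theorem normalizesTo_of_fst_sub_snd_le_one {n : ℕ} {w : Fin (n + 2) → ℤ × ℤ}
    (hw : IsNormalized w) (h : ∀ α, |(w α).1 - (w α).2| ≤ 1) :
    NormalizesTo w (semiFreeData n) := by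
  rcases Nat.eq_zero_or_pos n with rfl | hn
  · refine normalizesTo_of_fst_le_one hw fun α => ?_
    induction α using Fin.lastCases with
    | last => rw [hw.last, abs_one]
    | cast i =>
      obtain rfl := Subsingleton.elim i 0
      rw [Fin.castSucc_zero, hw.first, abs_zero]
      exact zero_le_one
  obtain ⟨W, hWw, hW0, hWl, hdet, hpos⟩ := hw.exists_enumeration
  have h' : ∀ j < n + 2, |(W j).1 - (W j).2| ≤ 1 := fun j hj => by
    have := h ⟨j, hj⟩
    rwa [hWw] at this
  obtain ⟨p, hp, hlt, hWp, hgt⟩ := exists_profile_of_abs_sub_le_one hn hW0 hWl hdet hpos h'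
  -- the label of `(1, 1)`, the pair on which the functional vanishes, becomes the first one
  refine normalizesTo_of_forall_lt W hWw p (by lia) (latticeShear p)
    (fun j hj => Or.inl ?_) (fun j hj => Or.inr ?_)
  · rcases Nat.eq_zero_or_pos j with rfl | h0
    · simp [hWp, semiFreeData, latticeShear]
    · rw [semiFreeData_mk_of_pos (by lia) h0]
      simp only [hgt (p + j) (by lia) hj, latticeShear, AddEquiv.coe_mk, Equiv.coe_fn_mk]
      push_cast
      ext <;> ring
  · rw [semiFreeData_mk_of_pos (by lia) (by lia)]
    simp only [hlt j hj, latticeShear, AddEquiv.coe_mk, Equiv.coe_fn_mk]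
    push_cast [show p ≤ n + 2 by lia]
    ext
    · simp
    · simp
      ring

/-- The coordinates of the functional are its values on the two end pairs `(1, 0)` and `(0, 1)`, so
they are `0` or `±1`. -/
theorem normalizesTo_of_exists_functional {n : ℕ} {w : Fin (n + 2) → ℤ × ℤ} (hw : IsNormalized w)
    {a b : ℤ} (hab : a ≠ 0 ∨ b ≠ 0) (h : ∀ α, |a * (w α).1 + b * (w α).2| ≤ 1) :
    NormalizesTo w (semiFreeData n) := by
  have hb := h 0
  have ha := h (Fin.last (n + 1))
  rw [hw.first] at hb
  rw [hw.last] at ha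
  simp only [mul_zero, mul_one, zero_add, add_zero] at ha hb
  rw [abs_le] at ha hb
  have hcases : (b = 0 ∧ (a = 1 ∨ a = -1)) ∨ (a = 0 ∧ (b = 1 ∨ b = -1)) ∨
      ((a = 1 ∨ a = -1) ∧ b = -a) ∨ ((a = 1 ∨ a = -1) ∧ b = a) := by lia
  simp only [abs_le] at h
  rcases hcases with ⟨hb, ha⟩ | ⟨ha, hb⟩ | ⟨ha, hb⟩ | ⟨ha, hb⟩
  · refine normalizesTo_of_fst_le_one hw fun α => abs_le.2 ?_
    have := h α
    rcases ha with rfl | rfl <;> subst hb <;> lia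
  · refine normalizesTo_of_snd_le_one hw fun α => abs_le.2 ?_
    have := h α
    rcases hb with rfl | rfl <;> subst ha <;> lia
  · refine normalizesTo_of_fst_sub_snd_le_one hw fun α => abs_le.2 ?_
    have := h α
    rcases ha with rfl | rfl <;> subst hb <;> lia
  · -- `m + n ≥ 2` on pairs other than the end pairs, so there are none
    refine normalizesTo_of_fst_le_one hw fun α => ?_
    by_cases h0 : α = 0
    · simp [h0, hw.first]
    by_cases hl : α = Fin.last (n + 1)
    · simp [hl, hw.last]
    have := hw.pos α h0 hl
    have := h α
    rcases ha with rfl | rfl <;> subst hb <;> lia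

/-! ### Transport along the change of basis -/

theorem NormalizesTo.of_addEquiv {n : ℕ} {v w w' : Fin (n + 2) → ℤ × ℤ} (e : (ℤ × ℤ) ≃+ (ℤ × ℤ))
    (hvw : ∀ α, e (v α) = w α ∨ e (v α) = -w α) (h : NormalizesTo w w') : NormalizesTo v w' := by
  obtain ⟨c, f, hf⟩ := h
  refine ⟨c, e.trans f, fun α => ?_⟩
  rw [AddEquiv.trans_apply]
  rcases hvw (c + α) with h1 | h1 <;> rcases hf α with h2 | h2 <;> simp [h1, h2]

theorem exists_pullback_functional (e : (ℤ × ℤ) ≃+ (ℤ × ℤ)) {a b : ℤ} (hab : a ≠ 0 ∨ b ≠ 0) :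
    ∃ a' b' : ℤ, (a' ≠ 0 ∨ b' ≠ 0) ∧
      ∀ x : ℤ × ℤ, a' * (e x).1 + b' * (e x).2 = a * x.1 + b * x.2 := by
  let l : ℤ × ℤ → ℤ := fun x => a * x.1 + b * x.2
  have key : ∀ y : ℤ × ℤ, l (e.symm (1, 0)) * y.1 + l (e.symm (0, 1)) * y.2 = l (e.symm y) := by
    intro y
    have hy : y = y.1 • ((1, 0) : ℤ × ℤ) + y.2 • ((0, 1) : ℤ × ℤ) := by ext <;> simp
    conv_rhs => rw [hy, map_add, map_zsmul, map_zsmul]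
    simp only [l, Prod.fst_add, Prod.snd_add, Prod.smul_fst, Prod.smul_snd, smul_eq_mul]
    ring
  refine ⟨l (e.symm (1, 0)), l (e.symm (0, 1)), ?_, fun x => by rw [key, e.symm_apply_apply]⟩
  by_contra! h0
  have h1 : ∀ x, l x = 0 := fun x => by
    rw [← e.symm_apply_apply x, ← key, h0.1, h0.2]
    simp
  have ha := h1 (1, 0)
  have hb := h1 (0, 1)
  simp only [l] at ha hb
  lia

end JoyceToric

theorem mainTheorem4 (n : ℕ) (M : Type*) [TopologicalSpace M] [T2Space M] [CompactSpace M]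
    [ConnectedSpace M] [ChartedSpace (EuclideanSpace ℝ (Fin 4)) M] [IsManifold (𝓡 4) ∞ M]
    [MulAction JoyceToric.Torus M]
    (hsmooth : ContMDiff (((𝓡 1).prod (𝓡 1)).prod (𝓡 4)) (𝓡 4) ∞
      (fun p : JoyceToric.Torus × M => p.1 • p.2))
    (g : JoyceToric.RiemMetric M) (v : Fin (n + 2) → ℤ × ℤ)
    (hJoyce : JoyceToric.IsJoyceMetric g v)
    (hsemifree : ∃ K : Subgroup JoyceToric.Torus,
      JoyceToric.IsCircleSubgroup K ∧ JoyceToric.IsSemiFree K M) :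
    ∃ w : Fin (n + 2) → ℤ × ℤ, JoyceToric.NormalizesTo v w ∧ w 0 = (0, 1) ∧
      -- labels start at 0 here, so that `k - α` reads `(n + 2) - (α + 1)`
      ∀ α : Fin (n + 2), α ≠ 0 → w α = (1, ((n : ℤ) + 2) - ((α : ℕ) + 1)) := by
  obtain ⟨π, q, w, e, -, hdata, hw, hvw, -⟩ := hJoyce
  obtain ⟨K, hK, hfree⟩ := hsemifree
  obtain ⟨a, b, hab, hweights⟩ := JoyceToric.IsSemiFree.exists_weights hdata hK hfree
  obtain ⟨a', b', hab', hpull⟩ := JoyceToric.exists_pullback_functional e hab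
  refine ⟨JoyceToric.semiFreeData n,
    .of_addEquiv e hvw (JoyceToric.normalizesTo_of_exists_functional hw hab' fun α => ?_), ?_, ?_⟩
  · have h1 := hweights α
    rw [← hpull] at h1
    rcases hvw α with h2 | h2
    · rwa [h2] at h1
    · rw [h2, ← abs_neg] at h1
      convert h1 using 2
      simp only [Prod.fst_neg, Prod.snd_neg]
      ring
  · simp [JoyceToric.semiFreeData]
  · intro α hα
    simp [JoyceToric.semiFreeData, hα]
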